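/- **Setting.** Let $M=(\mathcal S,\mathcal A,P,R,\gamma,\rho)$ be a discounted MDP with $\mathcal S$ an arbitrary measurable space, $\mathcal A$ finite, rewards in $[0,1]$ with mean $r(s,a)$, and $\gamma\in[0,1)$. For a policy $\pi$ let $d^\pi=(1-\gamma)\sum_{t\ge0}\gamma^tP_t(s_t=\cdot,a_t=\cdot;\pi)$ be its discounted occupancy, $J(\pi)=\mathbb E_{d^\pi}[r]$, $f(s,\pi)=\sum_a\pi(a|s)f(s,a)$, $(\mathcal T^\pi f)(s,a)=r(s,a)+\gamma\,\mathbb E_{s'\sim P(\cdot|s,a)}[f(s',\pi)]$, and $\|g\|_{2,\nu}=\sqrt{\mathbb E_\nu[g^2]}$. Let $V_{\max}\ge 1$, let $\mathcal F$ be a finite class of functions $\mathcal S\times\mathcal A\to[0,V_{\max}]$, $\mathcal W$ a finite class of functions $\mathcal S\times\mathcal A\to[0,B_w]$ containing the all-one function, and $\Pi$ a finite class of policies containing the uniform policy and the behavior policy $\mu$. The data set $\mathcal D=\{(s_i,a_i,r_i,s_i')\}_{i=1}^N$, $N\ge1$, is i.i.d. with $(s_i,a_i)\sim d^\mu$, $r_i\sim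 R(s_i,a_i)$, $s_i'\sim P(\cdot|s_i,a_i)$. **Assumptions.** (i) For every $\pi\in\Pi$, $\min_{f\in\mathcal F}\max_{\pi'\in\Pi}\|f-\mathcal T^\pi f\|_{2,d^{\pi'}}^2\le\epsilon_{\mathcal F}$. (ii) $\|w\|_{2,d^\mu}\le C^\star_{\ell_2}$ for all $w\in\mathcal W$. No comparator's density ratio is assumed to lie in $\mathcal W$. **Algorithms.** Given $\beta\ge0$, $K\ge1$ and a policy update rule $\mathsf{PO}$ with values in $\Pi$, start with $\pi_1$ uniform and for $k=1,\dots,K$ let $f_k$ be any minimizer over $f\in\mathcal F$ of $\mathcal L_{\mathcal D}(\pi_k,f)+\beta\,\mathcal E_{\mathcal D}(\pi_k,f)$ and $\pi_{k+1}=\mathsf{PO}(\pi_k,f_k,\mathcal D)$, where $\mathcal L_{\mathcal D}(\pi,f)=\frac1N\sum_i(f(s_i,\pi)-f(s_i,a_i))$ and, in Algorithm 1, $$\mathcal E_{\mathcal D}(\pi,f)=\max_{w\in\mathcal W}\Big|\tfrac1N\sum_i w(s_i,a_i)\big(f(s_i,a_i)-r_i-\gamma f(s_i',\pi)\big)\Big|,$$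 while in the $\mathcal W$-free Algorithm 2 only $w\equiv1$ is used. The output is the mixture $\bar\pi=\mathrm{Unif}(\pi_1,\dots,\pi_K)$, so that $J(\bar\pi)=\frac1K\sum_kJ(\pi_k)$. Put $\epsilon^{\pi}_{\rm opt}=\frac1K\sum_{k=1}^K\mathbb E_{s\sim d^\pi}[f_k(s,\pi)-f_k(s,\pi_k)]$. **Theorem (robust policy improvement).** There is an absolute constant $c>0$ such that the following holds in every such setting. (a) For every $N\ge1$ and $\delta\in(0,1)$, with probability at least $1-\delta$ over $\mathcal D$, for every $\beta\ge0$, $K\ge1$ and update rule $\mathsf{PO}$, every output $\bar\pi$ of Algorithm 1 or of Algorithm 2 satisfies $$J(\mu)-J(\bar\pi)\le c\,(\beta+1)\big(\epsilon_{\rm stat}+C^\star_{\ell_2}\sqrt{\epsilon_{\mathcal F}}\big)+\epsilon^\mu_{\rm opt},$$ $$\epsilon_{\rm stat}=V_{\max}C^\star_{\ell_2}\sqrt{\frac{\log(|\mathcal F||\Pi||\mathcal W|/\delta)}{N}}+\frac{V_{\max}B_w\log(|\mathcal F||\Pi||\mathcal W|/\delta)}{N}.$$ (b) Consequently, if $\mathsf{PO}$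 is no-regret (for every $\pi\in\Pi$, $\epsilon^\pi_{\rm opt}\le o(1)$ as $K\to\infty$, uniformly over critic sequences in $\mathcal F$ and over data sets), and if $\beta=\beta_N\ge0$ with $\beta_N=o(\sqrt N)$ and $K=K_N\to\infty$, then for every $\eta>0$ the probability that some output of either algorithm has $J(\mu)-J(\bar\pi)>c\,(\beta_N+1)C^\star_{\ell_2}\sqrt{\epsilon_{\mathcal F}}+\eta$ tends to $0$ as $N\to\infty$. In particular, when $\epsilon_{\mathcal F}=0$ the suboptimality of the output relative to the behavior policy vanishes in probability. -/

import Mathlib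

open MeasureTheory ProbabilityTheory Filter Topology Asymptotics

noncomputable section

namespace ACrab

variable {S A : Type*} [MeasurableSpace S] [MeasurableSpace A]

/-- An infinite-horizon discounted Markov decision process with state space `S` and action space
`A`; rewards are random and take values in `[0, 1]`. -/
structure MDP (S A : Type*) [MeasurableSpace S] [MeasurableSpace A] where
  /-- transition kernel -/
  P : Kernel (S × A) S
  markov_P : IsMarkovKernel P
  /-- reward distributions -/
  R : Kernel (S × A) ℝ
  markov_R : IsMarkovKernel R
  reward_mem : ∀ x, ∀ᵐ y ∂(R x), y ∈ Set.Icc (0 : ℝ) 1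
  /-- discount factor -/
  γ : ℝ
  γ_nonneg : 0 ≤ γ
  γ_lt_one : γ < 1
  /-- initial state distribution -/
  ρ : Measure S
  prob_ρ : IsProbabilityMeasure ρ

/-- Stationary stochastic policies `s ↦ π(· | s)`. -/
abbrev Policy (S A : Type*) [MeasurableSpace S] [MeasurableSpace A] :=
  {π : Kernel S A // IsMarkovKernel π}

/-- The policy that plays uniformly at random in every state. -/
def uniformPolicy (S A : Type*) [MeasurableSpace S] [MeasurableSpace A] [Fintype A] [Nonempty A] :
    Policy S A :=
  ⟨Kernel.const S (PMF.uniformOfFintype A).toMeasure, inferInstance⟩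

namespace MDP

/-- Expected reward function `r(s, a)`. -/
def r (M : MDP S A) (x : S × A) : ℝ := ∫ y, y ∂(M.R x)

/-- Law of the state `s_t` when `s_0 ∼ ρ` and actions are drawn from `π`. -/
def stateLaw (M : MDP S A) (π : Policy S A) : ℕ → Measure S
  | 0 => M.ρ
  | t + 1 => (M.stateLaw π t ⊗ₘ π.1).bind M.P

/-- Discounted state-action occupancy `d^π = (1 - γ) ∑ₜ γᵗ Pₜ(s_t = ·, a_t = ·; π)`. -/
def occupancy (M : MDP S A) (π : Policy S A) : Measure (S × A) :=
  ENNReal.ofReal (1 - M.γ) •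
    Measure.sum fun t : ℕ => ENNReal.ofReal (M.γ ^ t) • (M.stateLaw π t ⊗ₘ π.1)

/-- Normalized value `J(π) = E_{(s,a) ∼ d^π}[r(s,a)]`. -/
def J (M : MDP S A) (π : Policy S A) : ℝ := ∫ x, M.r x ∂(M.occupancy π)

end MDP

/-- `f(s, π) = ∑ₐ π(a | s) f(s, a)`. -/
def policyEval [Fintype A] (f : S × A → ℝ) (π : Policy S A) (s : S) : ℝ :=
  ∑ a, (π.1 s).real {a} * f (s, a)

/-- Bellman operator `(T^π f)(s,a) = r(s,a) + γ E_{s' ∼ P(· | s,a)}[f(s', π)]`. -/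
def MDP.bellman [Fintype A] (M : MDP S A) (π : Policy S A) (f : S × A → ℝ) (x : S × A) : ℝ :=
  M.r x + M.γ * ∫ s', policyEval f π s' ∂(M.P x)

/-- The weighted Euclidean norm `‖g‖_{2,ν} = √(E_ν[g²])`. -/
def norm2 {X : Type*} [MeasurableSpace X] (ν : Measure X) (g : X → ℝ) : ℝ :=
  √(∫ x, g x ^ 2 ∂ν)

/-- Approximate realizability: `min_{f ∈ F} max_ν ‖f - T^π f‖²_{2,ν} ≤ εF` for every `π ∈ Pi`, with
`ν` ranging over the (finitely many) admissible distributions `d^{π'}`, `π' ∈ Pi`. -/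
def ApproxRealizable [Fintype A] (M : MDP S A) (F : Finset (S × A → ℝ)) (Pi : Finset (Policy S A))
    (εF : ℝ) : Prop :=
  ∀ π ∈ Pi, ∃ f ∈ F, ∀ π' ∈ Pi,
    norm2 (M.occupancy π') (fun x => f x - M.bellman π f x) ^ 2 ≤ εF

/-- A data set of `N` samples `((s, a), (r, s'))`. -/
abbrev Dataset (S A : Type*) (N : ℕ) := Fin N → (S × A) × (ℝ × S)

/-- Law of a data set of `N` i.i.d. samples with `(s, a) ∼ d^μ`, `r ∼ R(s, a)`,
`s' ∼ P(· | s, a)`. -/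
def MDP.dataLaw (M : MDP S A) (μ : Policy S A) (N : ℕ) : Measure (Dataset S A N) :=
  Measure.pi fun _ => M.occupancy μ ⊗ₘ (M.R ×ₖ M.P)

/-- Empirical relative value `L_D(π, f) = (1/N) ∑ᵢ (f(sᵢ, π) - f(sᵢ, aᵢ))`. -/
def empValue [Fintype A] {N : ℕ} (D : Dataset S A N) (π : Policy S A) (f : S × A → ℝ) : ℝ :=
  (1 / (N : ℝ)) * ∑ i, (policyEval f π (D i).1.1 - f (D i).1)

/-- Empirical weighted average Bellman error
`E_D[w(s,a) (f(s,a) - r - γ f(s', π))]` for one weight function `w`. -/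
def empBellman [Fintype A] {N : ℕ} (γ : ℝ) (D : Dataset S A N) (w : S × A → ℝ)
    (π : Policy S A) (f : S × A → ℝ) : ℝ :=
  (1 / (N : ℝ)) * ∑ i, w (D i).1 * (f (D i).1 - (D i).2.1 - γ * policyEval f π (D i).2.2)

/-- The regularizer of A-Crab: the maximum over `w ∈ W` of the absolute empirical weighted average
Bellman error (`W` is finite; it is nonempty wherever this is used). -/
def regW [Fintype A] {N : ℕ} (γ : ℝ) (W : Finset (S × A → ℝ)) (D : Dataset S A N)
    (π : Policy S A) (f : S × A → ℝ) : ℝ :=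
  ⨆ w : {w // w ∈ W}, |empBellman γ D w.1 π f|

/-- The regularizer of the `W`-free variant: `|E_D[f(s,a) - r - γ f(s', π)]|`. -/
def regOne [Fintype A] {N : ℕ} (γ : ℝ) (D : Dataset S A N)
    (π : Policy S A) (f : S × A → ℝ) : ℝ :=
  |(1 / (N : ℝ)) * ∑ i, (f (D i).1 - (D i).2.1 - γ * policyEval f π (D i).2.2)|

/-- The policies `π_1, π_2, …` (indexed from `0`) produced by an update rule `upd` fed with the
critics `f_1, f_2, …`: `π_1` is uniform and `π_{k+1} = upd π_k f_k`. -/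
def policySeq [Fintype A] [Nonempty A] (upd : Policy S A → (S × A → ℝ) → Policy S A)
    (f : ℕ → S × A → ℝ) : ℕ → Policy S A
  | 0 => uniformPolicy S A
  | k + 1 => upd (policySeq upd f k) (f k)

/-- `f` is a sequence of critics of a `K`-round actor-critic run on the data set `D` with regularizer
`reg`: in each round `f k ∈ F` minimizes `L_D(π_k, ·) + β reg(π_k, ·)` over `F` (any minimizer),
after which the update rule turns `π_k` and `f k` into `π_{k+1}`. -/
def IsRun [Fintype A] [Nonempty A] {N : ℕ} (D : Dataset S A N) (F : Finset (S × A → ℝ))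
    (reg : Policy S A → (S × A → ℝ) → ℝ) (β : ℝ)
    (upd : Policy S A → (S × A → ℝ) → Policy S A) (K : ℕ) (f : ℕ → S × A → ℝ) : Prop :=
  ∀ k < K, f k ∈ F ∧ ∀ g ∈ F,
    empValue D (policySeq upd f k) (f k) + β * reg (policySeq upd f k) (f k) ≤
      empValue D (policySeq upd f k) g + β * reg (policySeq upd f k) g

/-- Critics of a run of A-Crab (weights from `W`) or of its `W`-free variant. -/
def IsACrabRun [Fintype A] [Nonempty A] {N : ℕ} (M : MDP S A) (D : Dataset S A N)
    (F W : Finset (S × A → ℝ)) (β : ℝ)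
    (upd : Policy S A → (S × A → ℝ) → Policy S A) (K : ℕ) (f : ℕ → S × A → ℝ) : Prop :=
  IsRun D F (regW M.γ W D) β upd K f ∨ IsRun D F (regOne M.γ D) β upd K f

/-- Value `J(π̄)` of the output `π̄ = Unif(π_1, …, π_K)`, the mixture that draws `k` uniformly once
and then follows `π_k`. -/
def MDP.mixtureValue (M : MDP S A) (π : ℕ → Policy S A) (K : ℕ) : ℝ :=
  (1 / (K : ℝ)) * ∑ k ∈ Finset.range K, M.J (π k)

/-- Optimization error against a comparator `π`:
`ε_opt^π = (1/K) ∑ₖ E_{s ∼ d^π}[f_k(s, π) - f_k(s, π_k)]`. -/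
def MDP.optError [Fintype A] (M : MDP S A) (π : Policy S A) (πs : ℕ → Policy S A)
    (f : ℕ → S × A → ℝ) (K : ℕ) : ℝ :=
  (1 / (K : ℝ)) * ∑ k ∈ Finset.range K,
    ∫ x, (policyEval (f k) π x.1 - policyEval (f k) (πs k) x.1) ∂(M.occupancy π)

/-- The update rule keeps the policies inside the class `Pi`. -/
def StaysIn (Pi : Finset (Policy S A)) (F : Finset (S × A → ℝ))
    (upd : Policy S A → (S × A → ℝ) → Policy S A) : Prop :=
  ∀ π ∈ Pi, ∀ f ∈ F, upd π f ∈ Pi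

/-- A policy optimization oracle `PO` (whose step may depend on the data set and on the number `K` of
rounds) is no-regret: against every comparator in `Pi` the average regret after `K` rounds is at most
`o(1)` as `K → ∞`, uniformly over all sequences of critics in `F` (and over the data). -/
def IsNoRegret [Fintype A] [Nonempty A] (M : MDP S A) (F : Finset (S × A → ℝ))
    (Pi : Finset (Policy S A))
    (PO : (N K : ℕ) → Dataset S A N → Policy S A → (S × A → ℝ) → Policy S A) : Prop :=
  ∀ π ∈ Pi, ∀ η > 0, ∃ K₀ : ℕ, ∀ K ≥ K₀, ∀ (N : ℕ) (D : Dataset S A N) (f : ℕ → S × A → ℝ),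
    (∀ k < K, f k ∈ F) → M.optError π (policySeq (PO N K D) f) f K ≤ η

/-- `ε_stat = Vmax C √(log(n/δ)/N) + Vmax B log(n/δ)/N`, with `n = |F| |Pi| |W|`. -/
def statError (Vmax C B : ℝ) (n : ℕ) (δ : ℝ) (N : ℕ) : ℝ :=
  Vmax * C * √(Real.log (n / δ) / N) + Vmax * B * Real.log (n / δ) / N

end ACrab

end

open ACrab

/-!
# Robust policy improvement for weighted-average-Bellman-error actor-critic

Write `L_μ(π, f) = E_{d^μ}[f(s, π) - f(s, a)]`. For every critic `f` of a policy `π`, the Bellman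
flow equation of the occupancy measures gives (`performance_difference`)

`J(μ) - J(π) = E_{d^π}[f - T^π f] - E_{d^μ}[f - T^π f] - L_μ(π, f)`.

Apply this with the critic `g ∈ F` that approximately solves the Bellman equation of `π`: the first
two terms are at most `√εF` each, so that only `-L_μ(π, g)` matters. The critic `f` of the algorithm
minimizes `L_D + β E_D`, whence `-L_D(π, g) ≤ -L_D(π, f) + β E_D(π, g)`. The regularizer of `g` is
small: by Cauchy–Schwarz its population value is at most `C √εF`, whatever the weight. Up to
concentration, `-L_D(π, f)` is `-L_μ(π, f) = E_{d^μ}[f(s, μ) - f(s, π)]`, the optimization error of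
the round (`Assumptions.one_round`). No density ratio enters, because the comparator is the policy
that generated the data.

Concentration is Bernstein's inequality (`bernstein`) for the summands of `L_D` and of the weighted
Bellman errors, whose second moments are at most `(2 Vmax C)²`, with a union bound over `F × Pi × W`
(`Assumptions.compl_goodEvent_le`). The union bound produces `log (4 n / δ)` with `n = |F||Pi||W|`,
which is a multiple of `log (n / δ)` only for `n ≥ 2`; if `Pi = {μ}` the bound is trivial.
Vanishing suboptimality follows by fixing the confidence level and letting `N` grow, as the
statistical error is `O(1/√N)` at each fixed `δ`.
-/

open ACrab

namespace ACrab

/-! ### Second moments and Bernstein's inequality -/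

section Concentration

variable {X : Type*} [MeasurableSpace X]

lemma norm2_nonneg (ν : Measure X) (g : X → ℝ) : 0 ≤ norm2 ν g := Real.sqrt_nonneg _

lemma sq_norm2 (ν : Measure X) (g : X → ℝ) : norm2 ν g ^ 2 = ∫ x, g x ^ 2 ∂ν :=
  Real.sq_sqrt (integral_nonneg fun _ => sq_nonneg _)

/-- Cauchy–Schwarz for bounded functions. -/
lemma abs_integral_mul_le_norm2 (ν : Measure X) [IsProbabilityMeasure ν] {f g : X → ℝ} {a b : ℝ}
    (hf : Measurable f) (hg : Measurable g) (hfa : ∀ x, |f x| ≤ a) (hgb : ∀ x, |g x| ≤ b) :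
    |∫ x, f x * g x ∂ν| ≤ norm2 ν f * norm2 ν g := by
  have hf2 : MemLp f (ENNReal.ofReal 2) ν :=
    MemLp.of_bound hf.aestronglyMeasurable a (ae_of_all _ hfa)
  have hg2 : MemLp g (ENNReal.ofReal 2) ν :=
    MemLp.of_bound hg.aestronglyMeasurable b (ae_of_all _ hgb)
  have h := integral_mul_norm_le_Lp_mul_Lq Real.HolderConjugate.two_two hf2 hg2
  have h2 : |∫ x, f x * g x ∂ν| ≤ ∫ x, ‖f x‖ * ‖g x‖ ∂ν := by
    simpa [norm_mul] using norm_integral_le_integral_norm (μ := ν) (fun x => f x * g x)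
  refine h2.trans (h.trans_eq ?_)
  simp [norm2, Real.sqrt_eq_rpow]

lemma abs_integral_le_norm2 (ν : Measure X) [IsProbabilityMeasure ν] {g : X → ℝ} {b : ℝ}
    (hg : Measurable g) (hgb : ∀ x, |g x| ≤ b) :
    |∫ x, g x ∂ν| ≤ norm2 ν g := by
  have h := abs_integral_mul_le_norm2 ν (f := fun _ => 1) (a := 1) measurable_const hg
    (by simp) hgb
  simpa [norm2] using h

lemma integrable_of_abs_le (ν : Measure X) [IsFiniteMeasure ν] {g : X → ℝ} {b : ℝ}
    (hg : Measurable g) (hgb : ∀ᵐ x ∂ν, |g x| ≤ b) : Integrable g ν :=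
  Integrable.of_bound hg.aestronglyMeasurable b hgb

/-- Exponential moment bound behind Bernstein's inequality, from `eˣ ≤ 1 + x + x²` on `[-1, 1]`.
The variable is not centred first, so that no factor is lost in its range. -/
lemma integral_exp_le (ν : Measure X) [IsProbabilityMeasure ν] {Y : X → ℝ} {b v t : ℝ}
    (hY : Measurable Y) (hYb : ∀ᵐ x ∂ν, |Y x| ≤ b) (hv : ∫ x, Y x ^ 2 ∂ν ≤ v)
    (ht : 0 ≤ t) (htb : t * b ≤ 1) :
    Integrable (fun x => Real.exp (t * Y x)) ν ∧
      ∫ x, Real.exp (t * Y x) ∂ν ≤ Real.exp (t * ∫ x, Y x ∂ν + t ^ 2 * v) := by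
  have hle : ∀ᵐ x ∂ν, |t * Y x| ≤ 1 := by
    filter_upwards [hYb] with x hx
    rw [abs_mul, abs_of_nonneg ht]
    exact (mul_le_mul_of_nonneg_left hx ht).trans htb
  have hint : Integrable (fun x => Real.exp (t * Y x)) ν := by
    refine integrable_of_abs_le ν (b := Real.exp 1) (by fun_prop) ?_
    filter_upwards [hle] with x hx
    rw [abs_of_pos (Real.exp_pos _)]
    exact Real.exp_le_exp.2 (abs_le.1 hx).2
  have hY1 : Integrable Y ν := integrable_of_abs_le ν hY hYb
  have hY2 : Integrable (fun x => Y x ^ 2) ν := by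
    refine integrable_of_abs_le ν (b := b ^ 2) (by fun_prop) ?_
    filter_upwards [hYb] with x hx
    rw [abs_of_nonneg (sq_nonneg _), ← sq_abs]
    exact pow_le_pow_left₀ (abs_nonneg _) hx 2
  refine ⟨hint, ?_⟩
  calc ∫ x, Real.exp (t * Y x) ∂ν
      ≤ ∫ x, (1 + t * Y x + t ^ 2 * Y x ^ 2) ∂ν := by
        refine integral_mono_ae hint
          (((integrable_const 1).add (hY1.const_mul t)).add (hY2.const_mul _)) ?_
        filter_upwards [hle] with x hx
        have := (abs_le.1 (Real.abs_exp_sub_one_sub_id_le hx)).2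
        nlinarith
    _ = 1 + t * ∫ x, Y x ∂ν + t ^ 2 * ∫ x, Y x ^ 2 ∂ν := by
        have h1 : Integrable (fun x => 1 + t * Y x) ν := (integrable_const 1).add (hY1.const_mul t)
        rw [integral_add h1 (hY2.const_mul _), integral_add (integrable_const 1) (hY1.const_mul t),
          integral_const_mul, integral_const_mul]
        simp
    _ ≤ 1 + t * ∫ x, Y x ∂ν + t ^ 2 * v := by gcongr
    _ ≤ Real.exp (t * ∫ x, Y x ∂ν + t ^ 2 * v) := by
        linarith [Real.add_one_le_exp (t * ∫ x, Y x ∂ν + t ^ 2 * v)]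

/-- Average of `Y` over a sample `D`. -/
noncomputable def empMean {N : ℕ} (Y : X → ℝ) (D : Fin N → X) : ℝ := (1 / (N : ℝ)) * ∑ i, Y (D i)

@[fun_prop]
lemma measurable_empMean {N : ℕ} {Y : X → ℝ} (hY : Measurable Y) :
    Measurable (empMean (N := N) Y) := by
  unfold empMean
  fun_prop

/-- Radius of the confidence interval in Bernstein's inequality: standard deviation `σ`, range
`[-b, b]`, failure probability `2 exp (-L)`. -/
noncomputable def bernsteinRadius (σ b L : ℝ) (N : ℕ) : ℝ := 2 * σ * √(L / N) + b * L / N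

/-- One-sided Bernstein inequality. -/
lemma bernstein_upper (ν : Measure X) [IsProbabilityMeasure ν] {Y : X → ℝ} {b σ L : ℝ} {N : ℕ}
    (hN : 1 ≤ N) (hb : 0 < b) (hσ : 0 < σ) (hL : 0 < L)
    (hY : Measurable Y) (hYb : ∀ᵐ x ∂ν, |Y x| ≤ b) (hv : ∫ x, Y x ^ 2 ∂ν ≤ σ ^ 2) :
    (Measure.pi fun _ : Fin N => ν)
      {D | bernsteinRadius σ b L N ≤ empMean Y D - ∫ x, Y x ∂ν} ≤ ENNReal.ofReal (Real.exp (-L)) := by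
  have hN0 : (0 : ℝ) < N := by exact_mod_cast hN
  set m := ∫ x, Y x ∂ν with hm
  set q := √(L / N) with hq
  have hq0 : 0 < q := Real.sqrt_pos.2 (by positivity)
  have hq2 : q ^ 2 * N = L := by
    rw [hq, Real.sq_sqrt (by positivity)]; field_simp
  -- With `q = √(L / N)` this is the choice `t = 1 / (b + σ / q)`: it makes `t b ≤ 1`,
  -- `t σ² ≤ σ q` and `t (σ q + b q²) = q²` hold together.
  set t := q / (b * q + σ) with ht
  have hden : 0 < b * q + σ := by positivity
  have ht0 : 0 < t := by positivity
  have hteq : t * (b * q + σ) = q := by rw [ht]; field_simp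
  have htb : t * b ≤ 1 := by
    rw [ht, div_mul_eq_mul_div, div_le_one hden]; nlinarith
  have htσ : t * σ ≤ q := by nlinarith [mul_pos ht0 (mul_pos hb hq0)]
  obtain ⟨hint, hmom⟩ := integral_exp_le ν hY hYb hv ht0.le htb
  set S : (Fin N → X) → ℝ := fun D => ∑ i, Y (D i) with hS
  have hprod : ∀ D : Fin N → X, Real.exp (t * S D) = ∏ i, Real.exp (t * Y (D i)) := by
    intro D
    rw [← Real.exp_sum, hS, Finset.mul_sum]
  have hmgf : mgf S (Measure.pi fun _ : Fin N => ν) t ≤ Real.exp (N * (t * m + t ^ 2 * σ ^ 2)) := by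
    unfold mgf
    simp_rw [hprod]
    rw [integral_fintype_prod_eq_pow (fun x => Real.exp (t * Y x)), Fintype.card_fin, Real.exp_nat_mul]
    exact pow_le_pow_left₀ (integral_nonneg fun _ => (Real.exp_pos _).le) hmom N
  have hintS : Integrable (fun D => Real.exp (t * S D)) (Measure.pi fun _ : Fin N => ν) := by
    simp_rw [hprod]
    exact Integrable.fintype_prod (f := fun _ x => Real.exp (t * Y x)) fun _ => hint
  have hcher := measure_ge_le_exp_mul_mgf (N * (bernsteinRadius σ b L N + m)) ht0.le hintS
  have hset : {D : Fin N → X | bernsteinRadius σ b L N ≤ empMean Y D - m} =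
      {D | N * (bernsteinRadius σ b L N + m) ≤ S D} := by
    ext D
    simp only [Set.mem_ofPred_eq, empMean, hS]
    rw [le_sub_iff_add_le, one_div_mul_eq_div, le_div_iff₀ hN0, mul_comm]
  rw [hset, ← ofReal_measureReal]
  refine ENNReal.ofReal_le_ofReal (hcher.trans ?_)
  calc _ ≤ Real.exp (-t * (N * (bernsteinRadius σ b L N + m))) *
        Real.exp (N * (t * m + t ^ 2 * σ ^ 2)) := by gcongr
    _ ≤ Real.exp (-L) := by
      rw [← Real.exp_add]
      refine Real.exp_le_exp.2 ?_
      have hrad : bernsteinRadius σ b L N = 2 * σ * q + b * q ^ 2 := by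
        rw [bernsteinRadius, ← hq, mul_div_assoc b, ← hq2, mul_div_cancel_right₀ _ hN0.ne']
      rw [hrad, ← hq2]
      have h1 : t * (σ * q + b * q ^ 2) = q ^ 2 := by
        linear_combination q * hteq
      have h2 : t ^ 2 * σ ^ 2 ≤ t * (σ * q) := by
        nlinarith [mul_le_mul_of_nonneg_left htσ (mul_pos ht0 hσ).le]
      nlinarith [mul_le_mul_of_nonneg_left h2 hN0.le]

/-- Bernstein's inequality. -/
lemma bernstein (ν : Measure X) [IsProbabilityMeasure ν] {Y : X → ℝ} {b σ L : ℝ} {N : ℕ}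
    (hN : 1 ≤ N) (hb : 0 < b) (hσ : 0 < σ) (hL : 0 < L)
    (hY : Measurable Y) (hYb : ∀ᵐ x ∂ν, |Y x| ≤ b) (hv : ∫ x, Y x ^ 2 ∂ν ≤ σ ^ 2) :
    (Measure.pi fun _ : Fin N => ν)
      {D | bernsteinRadius σ b L N ≤ |empMean Y D - ∫ x, Y x ∂ν|} ≤
        ENNReal.ofReal (2 * Real.exp (-L)) := by
  have h1 := bernstein_upper ν hN hb hσ hL hY hYb hv
  have h2 := bernstein_upper ν hN hb hσ hL (Y := fun x => -Y x) hY.neg (by simpa using hYb)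
    (by simpa using hv)
  have hsub : {D : Fin N → X | bernsteinRadius σ b L N ≤ |empMean Y D - ∫ x, Y x ∂ν|} ⊆
      {D | bernsteinRadius σ b L N ≤ empMean Y D - ∫ x, Y x ∂ν} ∪
      {D | bernsteinRadius σ b L N ≤ empMean (fun x => -Y x) D - ∫ x, -Y x ∂ν} := by
    intro D hD
    have hneg : empMean (fun x => -Y x) D = -empMean Y D := by simp [empMean]
    rcases le_abs.1 (Set.mem_ofPred_eq ▸ hD) with h | h
    · exact Or.inl h
    · refine Or.inr ?_
      simp only [Set.mem_ofPred_eq, hneg, integral_neg]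
      linarith
  refine (measure_mono hsub).trans ((measure_union_le _ _).trans ((add_le_add h1 h2).trans_eq ?_))
  rw [← ENNReal.ofReal_add (Real.exp_pos _).le (Real.exp_pos _).le, two_mul]

end Concentration

/-! ### Integrals against kernels -/

section Kernels

lemma measurable_kernel_integral {X Y : Type*} [MeasurableSpace X] [MeasurableSpace Y]
    (κ : Kernel X Y) {g : Y → ℝ} (hg : Measurable g) : Measurable fun x => ∫ y, g y ∂(κ x) :=
  hg.stronglyMeasurable.integral_kernel.measurable

lemma abs_integral_le_of_abs_le {X : Type*} [MeasurableSpace X] (ν : Measure X)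
    [IsProbabilityMeasure ν] {g : X → ℝ} {b : ℝ} (hgb : ∀ᵐ x ∂ν, |g x| ≤ b) :
    |∫ x, g x ∂ν| ≤ b := by
  simpa using norm_integral_le_of_norm_le_const (μ := ν) (f := g) hgb

lemma integral_compProd_fst {X Y : Type*} [MeasurableSpace X] [MeasurableSpace Y]
    (ν : Measure X) [SFinite ν] (κ : Kernel X Y) [IsMarkovKernel κ] {g : X → ℝ}
    (hg : Measurable g) : ∫ z, g z.1 ∂(ν ⊗ₘ κ) = ∫ x, g x ∂ν := by
  conv_rhs => rw [← Measure.fst_compProd ν κ, Measure.fst]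
  rw [integral_map measurable_fst.aemeasurable hg.aestronglyMeasurable]

lemma integral_bind_kernel {X Y : Type*} [MeasurableSpace X] [MeasurableSpace Y]
    (ν : Measure X) [IsFiniteMeasure ν] (κ : Kernel X Y) [IsMarkovKernel κ] {g : Y → ℝ} {b : ℝ}
    (hg : Measurable g) (hgb : ∀ y, |g y| ≤ b) :
    ∫ y, g y ∂(ν.bind κ) = ∫ x, (∫ y, g y ∂(κ x)) ∂ν := by
  have hint : Integrable (fun z : X × Y => g z.2) (ν ⊗ₘ κ) :=
    integrable_of_abs_le _ (hg.comp measurable_snd) (ae_of_all _ fun z => hgb z.2)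
  rw [← Measure.snd_compProd, Measure.snd,
    integral_map measurable_snd.aemeasurable hg.aestronglyMeasurable,
    Measure.integral_compProd hint]

end Kernels

/-! ### Occupancy measures and the Bellman flow equation -/

attribute [instance] MDP.markov_P MDP.markov_R MDP.prob_ρ

instance {S A : Type*} [MeasurableSpace S] [MeasurableSpace A] (π : Policy S A) :
    IsMarkovKernel π.1 := π.2

section Occupancy

variable {S A : Type*} [MeasurableSpace S] [MeasurableSpace A] (M : MDP S A) (π : Policy S A)

instance (t : ℕ) : IsProbabilityMeasure (M.stateLaw π t) := by
  induction t with
  | zero => exact M.prob_ρ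
  | succ t ih =>
    rw [MDP.stateLaw]
    infer_instance

/-- Discounted occupancy of the states alone. -/
noncomputable def MDP.stateOccupancy : Measure S :=
  ENNReal.ofReal (1 - M.γ) •
    Measure.sum fun t : ℕ => ENNReal.ofReal (M.γ ^ t) • M.stateLaw π t

lemma MDP.one_sub_γ_pos : 0 < 1 - M.γ := sub_pos.2 M.γ_lt_one

instance : IsProbabilityMeasure (M.stateOccupancy π) := by
  constructor
  have h : ∑' t : ℕ, ENNReal.ofReal (M.γ ^ t) = ENNReal.ofReal (1 - M.γ)⁻¹ := by
    rw [← ENNReal.ofReal_tsum_of_nonneg (fun t => pow_nonneg M.γ_nonneg t)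
      (summable_geometric_of_lt_one M.γ_nonneg M.γ_lt_one),
      tsum_geometric_of_lt_one M.γ_nonneg M.γ_lt_one]
  simp only [MDP.stateOccupancy, Measure.smul_apply, Measure.sum_apply _ MeasurableSet.univ,
    measure_univ, smul_eq_mul, mul_one, h]
  rw [← ENNReal.ofReal_mul M.one_sub_γ_pos.le, mul_inv_cancel₀ M.one_sub_γ_pos.ne',
    ENNReal.ofReal_one]

lemma MDP.occupancy_eq_compProd : M.occupancy π = M.stateOccupancy π ⊗ₘ π.1 := by
  rw [occupancy, stateOccupancy, Measure.compProd_smul_left, Measure.compProd_sum_left]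
  simp_rw [Measure.compProd_smul_left]

instance : IsProbabilityMeasure (M.occupancy π) := by
  rw [M.occupancy_eq_compProd]
  infer_instance

lemma MDP.hasSum_stateOccupancy {g : S → ℝ} {b : ℝ} (hg : Measurable g) (hgb : ∀ s, |g s| ≤ b) :
    HasSum (fun t : ℕ => M.γ ^ t * ((1 - M.γ) * ∫ s, g s ∂(M.stateLaw π t)))
      (∫ s, g s ∂(M.stateOccupancy π)) := by
  have hint : Integrable g (M.stateOccupancy π) := integrable_of_abs_le _ hg (ae_of_all _ hgb)
  have hint' : Integrable g (Measure.sum fun t : ℕ => ENNReal.ofReal (M.γ ^ t) • M.stateLaw π t) :=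
    (integrable_smul_measure (by simpa using M.γ_lt_one) ENNReal.ofReal_ne_top).1 hint
  have h := (hasSum_integral_measure hint').mul_left (1 - M.γ)
  rw [stateOccupancy, integral_smul_measure, ENNReal.toReal_ofReal M.one_sub_γ_pos.le, smul_eq_mul]
  refine h.congr_fun fun t => ?_
  rw [integral_smul_measure, ENNReal.toReal_ofReal (pow_nonneg M.γ_nonneg t), smul_eq_mul]
  ring

lemma integral_occupancy_fst {g : S → ℝ} (hg : Measurable g) :
    ∫ x, g x.1 ∂(M.occupancy π) = ∫ s, g s ∂(M.stateOccupancy π) := by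
  rw [M.occupancy_eq_compProd, integral_compProd_fst _ _ hg]

/-- The states at time `t + 1` are distributed as successors of the state-action pairs at
time `t`. -/
lemma integral_stateLaw_succ {g : S → ℝ} {b : ℝ} (hg : Measurable g) (hgb : ∀ s, |g s| ≤ b)
    (t : ℕ) :
    ∫ s, g s ∂(M.stateLaw π (t + 1)) =
      ∫ s, (∫ a, (∫ s', g s' ∂(M.P (s, a))) ∂(π.1 s)) ∂(M.stateLaw π t) := by
  have h2 : Integrable (fun x => ∫ s', g s' ∂(M.P x)) (M.stateLaw π t ⊗ₘ π.1) :=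
    integrable_of_abs_le _ (measurable_kernel_integral M.P hg)
      (ae_of_all _ fun x => abs_integral_le_of_abs_le _ (ae_of_all _ hgb))
  rw [MDP.stateLaw, integral_bind_kernel _ _ hg hgb, Measure.integral_compProd h2]

/-- Bellman flow equation: a state drawn from the discounted occupancy is an initial state with
probability `1 - γ`, and a successor of a pair drawn from the occupancy with probability `γ`. -/
lemma bellman_flow {g : S → ℝ} {b : ℝ} (hg : Measurable g) (hgb : ∀ s, |g s| ≤ b) :
    ∫ x, g x.1 ∂(M.occupancy π) =
      (1 - M.γ) * ∫ s, g s ∂M.ρ + M.γ * ∫ x, (∫ s', g s' ∂(M.P x)) ∂(M.occupancy π) := by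
  set G : S × A → ℝ := fun x => ∫ s', g s' ∂(M.P x) with hG
  have hGm : Measurable G := measurable_kernel_integral M.P hg
  have hGb : ∀ x, |G x| ≤ b := fun x => abs_integral_le_of_abs_le _ (ae_of_all _ hgb)
  have hGi : Integrable G (M.stateOccupancy π ⊗ₘ π.1) :=
    integrable_of_abs_le _ hGm (ae_of_all _ hGb)
  rw [integral_occupancy_fst _ _ hg, M.occupancy_eq_compProd, Measure.integral_compProd hGi]
  have hHm : Measurable fun s => ∫ a, G (s, a) ∂(π.1 s) :=
    (hGm.stronglyMeasurable.integral_kernel_prod_right' (κ := π.1)).measurable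
  have hHb : ∀ s, |∫ a, G (s, a) ∂(π.1 s)| ≤ b :=
    fun s => abs_integral_le_of_abs_le _ (ae_of_all _ fun a => hGb _)
  have hs := M.hasSum_stateOccupancy π hg hgb
  have hs' := (M.hasSum_stateOccupancy π hHm hHb).mul_left M.γ
  have h0 := (hasSum_nat_add_iff' 1).2 hs
  have heq := h0.unique (a₂ := M.γ * ∫ s, (∫ a, G (s, a) ∂(π.1 s)) ∂(M.stateOccupancy π)) <| by
    refine hs'.congr_fun fun t => ?_
    rw [integral_stateLaw_succ M π hg hgb]
    ring
  rw [sub_eq_iff_eq_add'.1 heq]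
  simp [MDP.stateLaw]

lemma MDP.measurable_r : Measurable M.r := measurable_kernel_integral M.R measurable_id

lemma MDP.abs_r_le (x : S × A) : |M.r x| ≤ 1 := by
  refine abs_integral_le_of_abs_le _ ?_
  filter_upwards [M.reward_mem x] with y hy
  exact (abs_of_nonneg hy.1).trans_le hy.2

variable [Fintype A] [MeasurableSingletonClass A]

lemma policyEval_eq_integral (f : S × A → ℝ) (s : S) :
    policyEval f π s = ∫ a, f (s, a) ∂(π.1 s) := by
  rw [integral_fintype (Integrable.of_finite)]
  simp [policyEval]

lemma measurable_policyEval {f : S × A → ℝ} (hf : Measurable f) :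
    Measurable (policyEval f π) := by
  unfold policyEval
  refine Finset.measurable_sum _ fun a _ => Measurable.mul ?_ (hf.comp (by fun_prop))
  exact (Kernel.measurable_coe π.1 (measurableSet_singleton a)).ennreal_toReal

lemma policyEval_mem_Icc {f : S × A → ℝ} {V : ℝ} (hf : ∀ x, f x ∈ Set.Icc 0 V) (s : S) :
    policyEval f π s ∈ Set.Icc 0 V := by
  rw [policyEval_eq_integral]
  refine ⟨integral_nonneg fun a => (hf _).1, ?_⟩
  exact (le_abs_self _).trans (abs_integral_le_of_abs_le _
    (ae_of_all _ fun a => (abs_of_nonneg (hf _).1).trans_le (hf _).2))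

lemma abs_policyEval_le {f : S × A → ℝ} {V : ℝ} (hf : ∀ x, f x ∈ Set.Icc 0 V) (s : S) :
    |policyEval f π s| ≤ V :=
  (abs_of_nonneg (policyEval_mem_Icc π hf s).1).trans_le (policyEval_mem_Icc π hf s).2

lemma MDP.measurable_bellman {f : S × A → ℝ} (hf : Measurable f) :
    Measurable (M.bellman π f) :=
  M.measurable_r.add
    ((measurable_kernel_integral M.P (measurable_policyEval π hf)).const_mul M.γ)

lemma MDP.abs_sub_bellman_le {f : S × A → ℝ} {V : ℝ} (hf : ∀ x, f x ∈ Set.Icc 0 V) (x : S × A) :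
    |f x - M.bellman π f x| ≤ V + (1 + M.γ * V) := by
  have h1 := M.abs_r_le x
  have h2 : |∫ s', policyEval f π s' ∂(M.P x)| ≤ V :=
    abs_integral_le_of_abs_le _ (ae_of_all _ fun s => abs_policyEval_le π hf s)
  have h3 : |f x| ≤ V := (abs_of_nonneg (hf x).1).trans_le (hf x).2
  refine (abs_sub _ _).trans (add_le_add h3 ((abs_add_le _ _).trans (add_le_add h1 ?_)))
  rw [abs_mul, abs_of_nonneg M.γ_nonneg]
  exact mul_le_mul_of_nonneg_left h2 M.γ_nonneg

/-- Actions of the occupancy measure of `π` are drawn from `π`. -/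
lemma integral_policyEval_occupancy {f : S × A → ℝ} {V : ℝ} (hf : Measurable f)
    (hfV : ∀ x, f x ∈ Set.Icc 0 V) :
    ∫ x, policyEval f π x.1 ∂(M.occupancy π) = ∫ x, f x ∂(M.occupancy π) := by
  rw [integral_occupancy_fst _ _ (measurable_policyEval π hf), M.occupancy_eq_compProd, Measure.integral_compProd]
  · simp_rw [policyEval_eq_integral]
  · exact integrable_of_abs_le _ hf
      (ae_of_all _ fun x => (abs_of_nonneg (hfV x).1).trans_le (hfV x).2)

/-- Value of `ν` in terms of an arbitrary critic `f` and an arbitrary policy `π` evaluated by it. -/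
lemma J_eq (ν : Policy S A) {f : S × A → ℝ} {V : ℝ} (hf : Measurable f)
    (hfV : ∀ x, f x ∈ Set.Icc 0 V) :
    M.J ν = (1 - M.γ) * ∫ s, policyEval f π s ∂M.ρ
      - ∫ x, (f x - M.bellman π f x) ∂(M.occupancy ν)
      - ∫ x, (policyEval f π x.1 - f x) ∂(M.occupancy ν) := by
  have hπm := measurable_policyEval π hf
  have hπb := abs_policyEval_le π hfV
  have hflow := bellman_flow M ν hπm hπb
  have i1 : Integrable f (M.occupancy ν) := integrable_of_abs_le _ hf
    (ae_of_all _ fun x => (abs_of_nonneg (hfV x).1).trans_le (hfV x).2)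
  have i2 : Integrable (fun x => policyEval f π x.1) (M.occupancy ν) :=
    integrable_of_abs_le _ (hπm.comp measurable_fst) (ae_of_all _ fun x => hπb x.1)
  have i3 : Integrable M.r (M.occupancy ν) :=
    integrable_of_abs_le _ M.measurable_r (ae_of_all _ M.abs_r_le)
  have i4 : Integrable (fun x => M.γ * ∫ s', policyEval f π s' ∂(M.P x)) (M.occupancy ν) :=
    (integrable_of_abs_le _ (measurable_kernel_integral M.P hπm)
      (ae_of_all _ fun x => abs_integral_le_of_abs_le _ (ae_of_all _ hπb))).const_mul _
  rw [integral_sub i2 i1, hflow]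
  unfold MDP.bellman
  have i5 : Integrable (fun x => M.r x + M.γ * ∫ s', policyEval f π s' ∂(M.P x))
    (M.occupancy ν) := i3.add i4
  rw [integral_sub i1 i5, integral_add i3 i4, integral_const_mul, MDP.J]
  ring

/-- Performance difference through a critic `f` of `π`: the relative value of `f` up to its Bellman
error under the two occupancies. -/
lemma performance_difference (μ : Policy S A) {f : S × A → ℝ} {V : ℝ} (hf : Measurable f)
    (hfV : ∀ x, f x ∈ Set.Icc 0 V) :
    M.J μ - M.J π = ∫ x, (f x - M.bellman π f x) ∂(M.occupancy π)
      - ∫ x, (f x - M.bellman π f x) ∂(M.occupancy μ)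
      - ∫ x, (policyEval f π x.1 - f x) ∂(M.occupancy μ) := by
  have i1 : Integrable f (M.occupancy π) := integrable_of_abs_le _ hf
    (ae_of_all _ fun x => (abs_of_nonneg (hfV x).1).trans_le (hfV x).2)
  have i2 : Integrable (fun x => policyEval f π x.1) (M.occupancy π) :=
    integrable_of_abs_le _ ((measurable_policyEval π hf).comp measurable_fst)
      (ae_of_all _ fun x => abs_policyEval_le π hfV x.1)
  have h0 : ∫ x, (policyEval f π x.1 - f x) ∂(M.occupancy π) = 0 := by
    rw [integral_sub i2 i1, integral_policyEval_occupancy M π hf hfV, sub_self]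
  rw [J_eq M π μ hf hfV, J_eq M π π hf hfV, h0]
  ring

end Occupancy

/-! ### Concentration of the empirical losses -/

section Samples

variable {S A : Type*} [MeasurableSpace S] [MeasurableSpace A]

/-- Law of one sample `((s, a), (r, s'))` of the data set. -/
noncomputable def MDP.sampleLaw (M : MDP S A) (μ : Policy S A) : Measure ((S × A) × (ℝ × S)) :=
  M.occupancy μ ⊗ₘ (M.R ×ₖ M.P)

instance (M : MDP S A) (μ : Policy S A) : IsProbabilityMeasure (M.sampleLaw μ) := by
  unfold MDP.sampleLaw
  infer_instance

instance (M : MDP S A) (μ : Policy S A) (N : ℕ) : IsProbabilityMeasure (M.dataLaw μ N) := by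
  unfold MDP.dataLaw
  infer_instance

lemma MDP.ae_reward_mem (M : MDP S A) (μ : Policy S A) :
    ∀ᵐ z ∂(M.sampleLaw μ), z.2.1 ∈ Set.Icc (0 : ℝ) 1 := by
  refine (Measure.ae_compProd_iff ?_).2 (ae_of_all _ fun x => ?_)
  · exact measurableSet_Icc.preimage (by fun_prop)
  · rw [Kernel.prod_apply]
    exact Measure.quasiMeasurePreserving_fst.ae (M.reward_mem x)

variable [Fintype A]

/-- Summand of the empirical relative value `empValue`. -/
def valueSample (π : Policy S A) (f : S × A → ℝ) (z : (S × A) × (ℝ × S)) : ℝ :=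
  policyEval f π z.1.1 - f z.1

/-- Summand of the empirical weighted Bellman error `empBellman`. -/
def bellmanSample (γ : ℝ) (w : S × A → ℝ) (π : Policy S A) (f : S × A → ℝ)
    (z : (S × A) × (ℝ × S)) : ℝ :=
  w z.1 * (f z.1 - z.2.1 - γ * policyEval f π z.2.2)

variable [MeasurableSingletonClass A] (M : MDP S A) (π μ : Policy S A) {f w : S × A → ℝ}
  {V B C : ℝ}

lemma measurable_valueSample (hf : Measurable f) : Measurable (valueSample π f) :=
  ((measurable_policyEval π hf).comp (by fun_prop)).sub (hf.comp (by fun_prop))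

lemma measurable_bellmanSample (γ : ℝ) (hf : Measurable f) (hw : Measurable w) :
    Measurable (bellmanSample γ w π f) := by
  have := measurable_policyEval π hf
  unfold bellmanSample
  fun_prop

lemma abs_valueSample_le (hfV : ∀ x, f x ∈ Set.Icc 0 V) (z : (S × A) × (ℝ × S)) :
    |valueSample π f z| ≤ V := by
  have h1 := policyEval_mem_Icc π hfV z.1.1
  have h2 := hfV z.1
  rw [valueSample, abs_le]
  constructor <;> linarith [h1.1, h1.2, h2.1, h2.2]

lemma ae_abs_bellmanError_le (hV : 1 ≤ V) (hfV : ∀ x, f x ∈ Set.Icc 0 V) :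
    ∀ᵐ z ∂(M.sampleLaw μ), |f z.1 - z.2.1 - M.γ * policyEval f π z.2.2| ≤ 2 * V := by
  filter_upwards [M.ae_reward_mem μ] with z hz
  have h1 := policyEval_mem_Icc π hfV z.2.2
  have h2 := hfV z.1
  have h3 : 0 ≤ M.γ * policyEval f π z.2.2 := mul_nonneg M.γ_nonneg h1.1
  have h4 : M.γ * policyEval f π z.2.2 ≤ V := by
    nlinarith [M.γ_nonneg, M.γ_lt_one, h1.1, h1.2]
  rw [abs_le]
  constructor <;> linarith [hz.1, hz.2, h2.1, h2.2]

lemma integral_valueSample (hf : Measurable f) :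
    ∫ z, valueSample π f z ∂(M.sampleLaw μ) =
      ∫ x, (policyEval f π x.1 - f x) ∂(M.occupancy μ) :=
  integral_compProd_fst (M.occupancy μ) (M.R ×ₖ M.P)
    (((measurable_policyEval π hf).comp measurable_fst).sub hf)

lemma ae_abs_bellmanSample_le (hV : 1 ≤ V) (hfV : ∀ x, f x ∈ Set.Icc 0 V)
    (hwB : ∀ x, w x ∈ Set.Icc 0 B) :
    ∀ᵐ z ∂(M.sampleLaw μ), |bellmanSample M.γ w π f z| ≤ 2 * V * B := by
  filter_upwards [ae_abs_bellmanError_le M π μ hV hfV] with z hz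
  rw [bellmanSample, abs_mul, abs_of_nonneg (hwB _).1, mul_comm (2 * V)]
  exact mul_le_mul (hwB _).2 hz (abs_nonneg _) ((hwB z.1).1.trans (hwB z.1).2)

/-- A sample Bellman error is an unbiased estimate of the weighted Bellman error. -/
lemma integral_bellmanSample (hV : 1 ≤ V) (hf : Measurable f) (hfV : ∀ x, f x ∈ Set.Icc 0 V)
    (hw : Measurable w) (hwB : ∀ x, w x ∈ Set.Icc 0 B) :
    ∫ z, bellmanSample M.γ w π f z ∂(M.sampleLaw μ) =
      ∫ x, w x * (f x - M.bellman π f x) ∂(M.occupancy μ) := by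
  have hint : Integrable (bellmanSample M.γ w π f) (M.sampleLaw μ) :=
    integrable_of_abs_le _ (measurable_bellmanSample π M.γ hf hw)
      (ae_abs_bellmanSample_le M π μ hV hfV hwB)
  unfold MDP.sampleLaw at hint ⊢
  rw [Measure.integral_compProd hint]
  congr 1
  ext x
  have hr : Integrable (fun y : ℝ => y) (M.R x) := by
    refine integrable_of_abs_le _ (b := 1) measurable_id ?_
    filter_upwards [M.reward_mem x] with y hy
    exact (abs_of_nonneg hy.1).trans_le hy.2
  have hp : Integrable (policyEval f π) (M.P x) :=
    integrable_of_abs_le _ (measurable_policyEval π hf) (ae_of_all _ (abs_policyEval_le π hfV))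
  have h1 : Integrable (fun y : ℝ × S => y.1) ((M.R x).prod (M.P x)) := hr.comp_fst _
  have h2 : Integrable (fun y : ℝ × S => M.γ * policyEval f π y.2) ((M.R x).prod (M.P x)) :=
    (hp.comp_snd _).const_mul _
  have h3 : Integrable (fun y : ℝ × S => f x - y.1) ((M.R x).prod (M.P x)) :=
    (integrable_const _).sub h1
  simp only [bellmanSample]
  rw [Kernel.prod_apply, integral_const_mul, integral_sub h3 h2, integral_sub (integrable_const _) h1,
    integral_const_mul, integral_fun_fst (fun y : ℝ => y), integral_fun_snd (policyEval f π)]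
  simp [MDP.bellman, MDP.r, sub_sub]

lemma integral_sq_bellmanSample_le (hV : 1 ≤ V) (hfV : ∀ x, f x ∈ Set.Icc 0 V)
    (hw : Measurable w) (hwB : ∀ x, w x ∈ Set.Icc 0 B) (hwC : norm2 (M.occupancy μ) w ≤ C) :
    ∫ z, bellmanSample M.γ w π f z ^ 2 ∂(M.sampleLaw μ) ≤ (2 * V * C) ^ 2 := by
  have hw2 : Measurable fun x => w x ^ 2 := by fun_prop
  have hi : Integrable (fun z => (2 * V) ^ 2 * w z.1 ^ 2) (M.sampleLaw μ) := by
    refine (integrable_of_abs_le _ (b := B ^ 2) (by fun_prop) (ae_of_all _ fun z => ?_)).const_mul _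
    rw [abs_of_nonneg (sq_nonneg _)]
    exact pow_le_pow_left₀ (hwB _).1 (hwB _).2 2
  calc ∫ z, bellmanSample M.γ w π f z ^ 2 ∂(M.sampleLaw μ)
      ≤ ∫ z, (2 * V) ^ 2 * w z.1 ^ 2 ∂(M.sampleLaw μ) := by
        refine integral_mono_of_nonneg (ae_of_all _ fun z => sq_nonneg _) hi ?_
        filter_upwards [ae_abs_bellmanError_le M π μ hV hfV] with z hz
        rw [bellmanSample, mul_pow, mul_comm]
        exact mul_le_mul_of_nonneg_right (sq_le_sq' (abs_le.1 hz).1 (abs_le.1 hz).2) (sq_nonneg _)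
    _ = (2 * V) ^ 2 * norm2 (M.occupancy μ) w ^ 2 := by
        rw [integral_const_mul, sq_norm2]
        congr 1
        exact integral_compProd_fst (M.occupancy μ) (M.R ×ₖ M.P) hw2
    _ ≤ (2 * V * C) ^ 2 := by
        rw [mul_pow (2 * V)]
        exact mul_le_mul_of_nonneg_left (pow_le_pow_left₀ (norm2_nonneg _ _) hwC 2) (sq_nonneg _)

end Samples

/-- The standing assumptions on the function classes, the weights and the policies. -/
structure Assumptions {S A : Type*} [MeasurableSpace S] [MeasurableSpace A] [Fintype A]
    [Nonempty A] [MeasurableSingletonClass A] (M : MDP S A) (F W : Finset (S × A → ℝ))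
    (Pi : Finset (Policy S A)) (μ : Policy S A) (Vmax Bw C εF : ℝ) : Prop where
  one_le_Vmax : 1 ≤ Vmax
  critics : ∀ f ∈ F, Measurable f ∧ ∀ x, f x ∈ Set.Icc 0 Vmax
  weights : ∀ w ∈ W, Measurable w ∧ ∀ x, w x ∈ Set.Icc 0 Bw
  one_mem : (fun _ => 1) ∈ W
  uniform_mem : uniformPolicy S A ∈ Pi
  behavior_mem : μ ∈ Pi
  realizable : ApproxRealizable M F Pi εF
  norm_weights : ∀ w ∈ W, norm2 (M.occupancy μ) w ≤ C

/-- Data sets on which all empirical losses are within `ρ` of their expectations. -/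
def goodEvent {S A : Type*} [MeasurableSpace S] [MeasurableSpace A] [Fintype A]
    (M : MDP S A) (F W : Finset (S × A → ℝ)) (Pi : Finset (Policy S A)) (μ : Policy S A)
    (ρ : ℝ) (N : ℕ) : Set (Dataset S A N) :=
  ⋂ p ∈ F ×ˢ Pi ×ˢ W,
    {D | |empMean (valueSample p.2.1 p.1) D - ∫ z, valueSample p.2.1 p.1 z ∂(M.sampleLaw μ)| < ρ} ∩
    {D | |empMean (bellmanSample M.γ p.2.2 p.2.1 p.1) D
      - ∫ z, bellmanSample M.γ p.2.2 p.2.1 p.1 z ∂(M.sampleLaw μ)| < ρ}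

section Guarantee

variable {S A : Type*} [MeasurableSpace S] [MeasurableSpace A] [Fintype A] [Nonempty A]
  [MeasurableSingletonClass A] {M : MDP S A} {F W : Finset (S × A → ℝ)}
  {Pi : Finset (Policy S A)} {μ : Policy S A} {Vmax Bw C εF : ℝ}

namespace Assumptions

lemma one_le_Bw (h : Assumptions M F W Pi μ Vmax Bw C εF) : 1 ≤ Bw := by
  obtain ⟨s⟩ := M.ρ.nonempty_of_neZero
  obtain ⟨a⟩ := ‹Nonempty A›
  exact ((h.weights _ h.one_mem).2 (s, a)).2

lemma one_le_C (h : Assumptions M F W Pi μ Vmax Bw C εF) : 1 ≤ C := by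
  simpa [norm2] using h.norm_weights _ h.one_mem

lemma measurableSet_goodEvent (h : Assumptions M F W Pi μ Vmax Bw C εF)
    (ρ : ℝ) (N : ℕ) : MeasurableSet (goodEvent M F W Pi μ ρ N) := by
  refine Finset.measurableSet_biInter _ fun p hp => ?_
  simp only [Finset.mem_product] at hp
  have hf := (h.critics _ hp.1).1
  have hw := (h.weights _ hp.2.2).1
  refine MeasurableSet.inter ?_ ?_
  · exact measurableSet_lt
      (((measurable_empMean (measurable_valueSample _ hf)).sub_const _).abs) measurable_const
  · exact measurableSet_lt
      (((measurable_empMean (measurable_bellmanSample _ _ hf hw)).sub_const _).abs)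
      measurable_const

/-- Bernstein's inequality and a union bound over `F × Pi × W`; each triple accounts for four
one-sided deviations. -/
lemma compl_goodEvent_le (h : Assumptions M F W Pi μ Vmax Bw C εF)
    {N : ℕ} (hN : 1 ≤ N) {L : ℝ} (hL : 0 < L) :
    M.dataLaw μ N (goodEvent M F W Pi μ (bernsteinRadius (2 * Vmax * C) (2 * Vmax * Bw) L N) N)ᶜ ≤
      ENNReal.ofReal ((F.card * Pi.card * W.card : ℕ) * (4 * Real.exp (-L))) := by
  have hV := h.one_le_Vmax
  have hB := h.one_le_Bw
  have hC := h.one_le_C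
  have hσ : 0 < 2 * Vmax * C := by positivity
  have hb : 0 < 2 * Vmax * Bw := by positivity
  set ρ := bernsteinRadius (2 * Vmax * C) (2 * Vmax * Bw) L N
  have hcard : F.card * Pi.card * W.card = (F ×ˢ Pi ×ˢ W).card := by
    simp [Finset.card_product, mul_assoc]
  rw [goodEvent, Set.compl_iInter₂, hcard, ENNReal.ofReal_mul (by positivity), ENNReal.ofReal_natCast,
    ← nsmul_eq_mul, ← Finset.sum_const]
  refine (measure_biUnion_finset_le _ _).trans (Finset.sum_le_sum fun p hp => ?_)
  simp only [Finset.mem_product] at hp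
  obtain ⟨hf, hfV⟩ := h.critics _ hp.1
  obtain ⟨hw, hwB⟩ := h.weights _ hp.2.2
  rw [Set.compl_inter]
  refine (measure_union_le _ _).trans ?_
  have hval := bernstein (M.sampleLaw μ) (L := L) hN hb hσ hL (measurable_valueSample p.2.1 hf)
    (ae_of_all _ fun z => (abs_valueSample_le p.2.1 hfV z).trans (by nlinarith)) (by
      refine (abs_le.1 (abs_integral_le_of_abs_le (b := Vmax ^ 2) _ (ae_of_all _ fun z => ?_))).2.trans
        (pow_le_pow_left₀ (by positivity) (by nlinarith) 2)
      rw [abs_of_nonneg (sq_nonneg _), ← sq_abs]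
      exact pow_le_pow_left₀ (abs_nonneg _) (abs_valueSample_le p.2.1 hfV z) 2)
  have hbel := bernstein (M.sampleLaw μ) (L := L) hN hb hσ hL
    (measurable_bellmanSample p.2.1 M.γ hf hw) (ae_abs_bellmanSample_le M p.2.1 μ hV hfV hwB)
    (integral_sq_bellmanSample_le M p.2.1 μ hV hfV hw hwB (h.norm_weights _ hp.2.2))
  have hsum : ENNReal.ofReal (4 * Real.exp (-L)) =
      ENNReal.ofReal (2 * Real.exp (-L)) + ENNReal.ofReal (2 * Real.exp (-L)) := by
    rw [← ENNReal.ofReal_add (by positivity) (by positivity)]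
    ring_nf
  rw [hsum]
  refine add_le_add (le_trans (le_of_eq ?_) hval) (le_trans (le_of_eq ?_) hbel)
  · congr 1
    ext D
    simp [ρ]
  · congr 1
    ext D
    simp [ρ]

end Assumptions
end Guarantee

/-! ### Guarantees on the good event -/

section Runs

variable {S A : Type*} [MeasurableSpace S] [MeasurableSpace A] [Fintype A]
  {M : MDP S A} {F W : Finset (S × A → ℝ)} {μ : Policy S A}

lemma IsACrabRun.mem [Nonempty A] {N : ℕ} {D : Dataset S A N} {β : ℝ}
    {upd : Policy S A → (S × A → ℝ) → Policy S A} {K : ℕ} {f : ℕ → S × A → ℝ}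
    (hrun : IsACrabRun M D F W β upd K f) : ∀ k < K, f k ∈ F := by
  rcases hrun with hr | hr <;> exact fun k hk => (hr k hk).1

/-- Rounds are averaged: a bound for every round, up to the optimization error of the round, is
a bound for the mixture. -/
lemma sub_mixtureValue_le {πs : ℕ → Policy S A} {f : ℕ → S × A → ℝ} {K : ℕ} (hK : 1 ≤ K)
    {b : ℝ} (hb : ∀ k < K, M.J μ - M.J (πs k) ≤
      b + ∫ x, (policyEval (f k) μ x.1 - policyEval (f k) (πs k) x.1) ∂(M.occupancy μ)) :
    M.J μ - M.mixtureValue πs K ≤ b + M.optError μ πs f K := by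
  have hK0 : (0 : ℝ) < K := by exact_mod_cast hK
  have hsum := Finset.sum_le_sum fun k hk => hb k (Finset.mem_range.1 hk)
  rw [Finset.sum_sub_distrib, Finset.sum_add_distrib] at hsum
  simp only [Finset.sum_const, Finset.card_range, nsmul_eq_mul] at hsum
  rw [MDP.mixtureValue, MDP.optError, one_div_mul_eq_div, one_div_mul_eq_div, sub_le_iff_le_add,
    add_assoc, ← add_div, ← sub_le_iff_le_add', le_div_iff₀ hK0]
  linarith

end Runs

section Deterministic

variable {S A : Type*} [MeasurableSpace S] [MeasurableSpace A] [Fintype A] [Nonempty A]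
  [MeasurableSingletonClass A] {M : MDP S A} {F W : Finset (S × A → ℝ)}
  {Pi : Finset (Policy S A)} {μ : Policy S A} {Vmax Bw C εF : ℝ}

namespace Assumptions

lemma abs_empValue_sub_lt (h : Assumptions M F W Pi μ Vmax Bw C εF) {ρ : ℝ} {N : ℕ}
    {D : Dataset S A N} (hD : D ∈ goodEvent M F W Pi μ ρ N) {π : Policy S A} (hπ : π ∈ Pi)
    {f : S × A → ℝ} (hf : f ∈ F) :
    |empValue D π f - ∫ x, (policyEval f π x.1 - f x) ∂(M.occupancy μ)| < ρ := by
  rw [← integral_valueSample M π μ (h.critics f hf).1]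
  exact (Set.mem_iInter₂.1 hD (f, π, fun _ => 1) (by simp [hf, hπ, h.one_mem])).1

lemma abs_empBellman_sub_lt (h : Assumptions M F W Pi μ Vmax Bw C εF) {ρ : ℝ} {N : ℕ}
    {D : Dataset S A N} (hD : D ∈ goodEvent M F W Pi μ ρ N) {π : Policy S A} (hπ : π ∈ Pi)
    {f w : S × A → ℝ} (hf : f ∈ F) (hw : w ∈ W) :
    |empBellman M.γ D w π f - ∫ x, w x * (f x - M.bellman π f x) ∂(M.occupancy μ)| < ρ := by
  rw [← integral_bellmanSample M π μ h.one_le_Vmax (h.critics f hf).1 (h.critics f hf).2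
    (h.weights w hw).1 (h.weights w hw).2]
  exact (Set.mem_iInter₂.1 hD (f, π, w) (by simp [hf, hπ, hw])).2

/-- By Cauchy–Schwarz, a critic with small Bellman error under the data distribution has a small
empirical regularizer, whatever the weight. -/
lemma abs_empBellman_le (h : Assumptions M F W Pi μ Vmax Bw C εF) {ρ : ℝ} {N : ℕ}
    {D : Dataset S A N} (hD : D ∈ goodEvent M F W Pi μ ρ N) {π : Policy S A} (hπ : π ∈ Pi)
    {f w : S × A → ℝ} (hf : f ∈ F) (hw : w ∈ W)
    (hε : norm2 (M.occupancy μ) (fun x => f x - M.bellman π f x) ≤ √εF) :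
    |empBellman M.γ D w π f| ≤ C * √εF + ρ := by
  have hcs := abs_integral_mul_le_norm2 (M.occupancy μ) (g := fun x => f x - M.bellman π f x)
    (h.weights w hw).1 ((h.critics f hf).1.sub (M.measurable_bellman π (h.critics f hf).1))
    (fun x => (abs_of_nonneg ((h.weights w hw).2 x).1).trans_le ((h.weights w hw).2 x).2)
    (M.abs_sub_bellman_le π (h.critics f hf).2)
  have hmul := mul_le_mul (h.norm_weights w hw) hε (norm2_nonneg _ _)
    (zero_le_one.trans h.one_le_C)
  have hdev := h.abs_empBellman_sub_lt hD hπ hf hw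
  have := abs_sub_abs_le_abs_sub (empBellman M.γ D w π f)
    (∫ x, w x * (f x - M.bellman π f x) ∂(M.occupancy μ))
  linarith

/-- One round of the algorithm. The critic `g` realizing the value of `π` turns `J μ - J π` into
its relative value; since the critic `f` of the algorithm minimizes the penalized empirical
relative value, that of `g` is not much smaller, and the relative value of `f` against `μ` is
the optimization error. -/
lemma one_round (h : Assumptions M F W Pi μ Vmax Bw C εF) {ρ β : ℝ} {N : ℕ}
    {D : Dataset S A N} (hD : D ∈ goodEvent M F W Pi μ ρ N) (hβ : 0 ≤ β)
    {reg : Policy S A → (S × A → ℝ) → ℝ} (hreg : reg = regW M.γ W D ∨ reg = regOne M.γ D)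
    {π : Policy S A} (hπ : π ∈ Pi) {f : S × A → ℝ} (hf : f ∈ F)
    (hmin : ∀ g ∈ F, empValue D π f + β * reg π f ≤ empValue D π g + β * reg π g) :
    M.J μ - M.J π ≤ 2 * √εF + 2 * ρ + β * (C * √εF + ρ) +
      ∫ x, (policyEval f μ x.1 - policyEval f π x.1) ∂(M.occupancy μ) := by
  obtain ⟨g, hg, hgε⟩ := h.realizable π hπ
  obtain ⟨hfm, hfV⟩ := h.critics f hf
  obtain ⟨hgm, hgV⟩ := h.critics g hg
  have hn : ∀ π' ∈ Pi, norm2 (M.occupancy π') (fun x => g x - M.bellman π g x) ≤ √εF :=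
    fun π' hπ' => Real.le_sqrt_of_sq_le (hgε π' hπ')
  have hone : ∀ g, regOne M.γ D π g = |empBellman M.γ D (fun _ => 1) π g| := fun g => by
    simp [regOne, empBellman]
  have hreg0 : 0 ≤ reg π f := by
    rcases hreg with rfl | rfl
    · exact Real.iSup_nonneg fun _ => abs_nonneg _
    · exact abs_nonneg _
  have hregg : reg π g ≤ C * √εF + ρ := by
    have hw := fun w hw => h.abs_empBellman_le hD hπ hg (w := w) hw (hn μ h.behavior_mem)
    rcases hreg with rfl | rfl
    · have : Nonempty {w // w ∈ W} := ⟨⟨_, h.one_mem⟩⟩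
      exact ciSup_le fun w => hw w.1 w.2
    · rw [hone]
      exact hw _ h.one_mem
  have hmean : ∀ π' ∈ Pi, |∫ x, (g x - M.bellman π g x) ∂(M.occupancy π')| ≤ √εF :=
    fun π' hπ' => (abs_integral_le_norm2 _ (hgm.sub (M.measurable_bellman π hgm))
      (M.abs_sub_bellman_le π hgV)).trans (hn π' hπ')
  have hpd := performance_difference M π μ hgm hgV
  have h1 := abs_le.1 (hmean π hπ)
  have h2 := abs_le.1 (hmean μ h.behavior_mem)
  have h3 := abs_lt.1 (h.abs_empValue_sub_lt hD hπ hf)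
  have h4 := abs_lt.1 (h.abs_empValue_sub_lt hD hπ hg)
  have h5 := hmin g hg
  have h6 := mul_le_mul_of_nonneg_left hregg hβ
  have h7 := mul_nonneg hβ hreg0
  have hev : ∀ ν : Policy S A, Integrable (fun x => policyEval f ν x.1) (M.occupancy μ) :=
    fun ν => integrable_of_abs_le _ ((measurable_policyEval ν hfm).comp measurable_fst)
      (ae_of_all _ fun x => abs_policyEval_le ν hfV x.1)
  have hfi : Integrable f (M.occupancy μ) := integrable_of_abs_le _ hfm
    (ae_of_all _ fun x => (abs_of_nonneg (hfV x).1).trans_le (hfV x).2)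
  rw [integral_sub (hev π) hfi] at h3
  rw [integral_sub (hev μ) (hev π), integral_policyEval_occupancy M μ hfm hfV]
  linarith [h1.1, h1.2, h2.1, h2.2, h3.1, h3.2, h4.1, h4.2]

lemma policySeq_mem (h : Assumptions M F W Pi μ Vmax Bw C εF)
    {upd : Policy S A → (S × A → ℝ) → Policy S A} (hupd : StaysIn Pi F upd) {K : ℕ}
    {f : ℕ → S × A → ℝ} (hf : ∀ k < K, f k ∈ F) : ∀ k ≤ K, policySeq upd f k ∈ Pi
  | 0, _ => h.uniform_mem
  | k + 1, hk => hupd _ (h.policySeq_mem hupd hf k (Nat.le_of_succ_le hk)) _ (hf k hk)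

end Assumptions

end Deterministic

/-! ### Robust policy improvement -/

lemma statError_nonneg {Vmax C B δ : ℝ} {n : ℕ} (N : ℕ) (hV : 0 ≤ Vmax) (hC : 0 ≤ C) (hB : 0 ≤ B)
    (hn : 1 ≤ n) (hδ0 : 0 < δ) (hδ1 : δ < 1) : 0 ≤ statError Vmax C B n δ N := by
  have hn' : (1 : ℝ) ≤ n := by exact_mod_cast hn
  have : 0 ≤ Real.log (n / δ) := Real.log_nonneg ((one_le_div hδ0).2 (by linarith))
  unfold statError
  positivity

/-- The factor `4` inside the logarithm from the union bound is absorbed once `n ≥ 2`. -/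
lemma bernsteinRadius_le_statError {Vmax C B δ : ℝ} {n N : ℕ} (hV : 0 ≤ Vmax) (hC : 0 ≤ C)
    (hB : 0 ≤ B) (hn : 2 ≤ n) (hδ0 : 0 < δ) (hδ1 : δ < 1) :
    bernsteinRadius (2 * Vmax * C) (2 * Vmax * B) (Real.log (4 * n / δ)) N ≤
      8 * statError Vmax C B n δ N := by
  have hn' : (2 : ℝ) ≤ n := by exact_mod_cast hn
  have h2 : 2 ≤ n / δ := (le_div_iff₀ hδ0).2 (by nlinarith)
  have hl : 0 ≤ Real.log (n / δ) := Real.log_nonneg (by linarith)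
  have hL : Real.log (4 * n / δ) ≤ 3 * Real.log (n / δ) := by
    have : (3 : ℝ) * Real.log (n / δ) = Real.log ((n / δ) ^ 3) := by simp [Real.log_pow]
    rw [this, mul_div_assoc]
    refine Real.log_le_log (by positivity) ?_
    have : (4 : ℝ) ≤ (n / δ) ^ 2 := by nlinarith
    nlinarith
  have hs : √(Real.log (4 * n / δ) / N) ≤ 2 * √(Real.log (n / δ) / N) := by
    rw [Real.sqrt_le_left (by positivity), mul_pow, Real.sq_sqrt (by positivity), ← mul_div_assoc]
    gcongr
    linarith
  have hLN : Real.log (4 * n / δ) / N ≤ 3 * (Real.log (n / δ) / N) := by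
    rw [← mul_div_assoc]
    gcongr
  have hl' : 0 ≤ Real.log (n / δ) / N := by positivity
  unfold bernsteinRadius statError
  rw [mul_div_assoc (2 * Vmax * B), mul_div_assoc (Vmax * B)]
  have e1 := mul_le_mul_of_nonneg_left hs (mul_nonneg hV hC)
  have e2 := mul_le_mul_of_nonneg_left hLN (mul_nonneg hV hB)
  have e3 := mul_nonneg (mul_nonneg hV hB) hl'
  linarith

section Main

variable {S A : Type*} [MeasurableSpace S] [MeasurableSpace A] [Fintype A] [Nonempty A]
  [MeasurableSingletonClass A] {M : MDP S A} {F W : Finset (S × A → ℝ)}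
  {Pi : Finset (Policy S A)} {μ : Policy S A} {Vmax Bw C εF : ℝ}

/-- Suboptimality bound with confidence `1 - δ`. -/
lemma Assumptions.high_probability_bound (h : Assumptions M F W Pi μ Vmax Bw C εF) {N : ℕ} {δ : ℝ}
    (hN : 1 ≤ N) (hδ0 : 0 < δ) (hδ1 : δ < 1) :
    ∃ E : Set (Dataset S A N), MeasurableSet E ∧
      ENNReal.ofReal (1 - δ) ≤ M.dataLaw μ N E ∧
      ∀ D ∈ E, ∀ (β : ℝ) (K : ℕ) (upd : Policy S A → (S × A → ℝ) → Policy S A)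
        (f : ℕ → S × A → ℝ),
        0 ≤ β → 1 ≤ K → StaysIn Pi F upd → IsACrabRun M D F W β upd K f →
        M.J μ - M.mixtureValue (policySeq upd f) K ≤
          16 * ((β + 1) *
            (statError Vmax C Bw (F.card * Pi.card * W.card) δ N + C * √εF)) +
          M.optError μ (policySeq upd f) f K := by
  have hV : 0 ≤ Vmax := zero_le_one.trans h.one_le_Vmax
  have hB : 0 ≤ Bw := zero_le_one.trans h.one_le_Bw
  have hC := h.one_le_C
  have hC0 : 0 ≤ C := zero_le_one.trans hC
  have hF : 0 < F.card := by
    obtain ⟨f, hf, -⟩ := h.realizable _ h.uniform_mem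
    exact Finset.card_pos.2 ⟨f, hf⟩
  have hW : 0 < W.card := Finset.card_pos.2 ⟨_, h.one_mem⟩
  have hP : 0 < Pi.card := Finset.card_pos.2 ⟨_, h.behavior_mem⟩
  set n := F.card * Pi.card * W.card with hn
  have hn1 : 1 ≤ n := Nat.mul_pos (Nat.mul_pos hF hP) hW
  have hstat := statError_nonneg N hV hC0 hB hn1 hδ0 hδ1
  by_cases hP1 : Pi.card ≤ 1
  · -- The only policy is `μ`. This case is separate because `log (n / δ)` can be arbitrarily
    -- small when `n = 1`, and then does not dominate `log (4 n / δ)`.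
    refine ⟨Set.univ, MeasurableSet.univ, ?_, fun D _ β K upd f hβ hK hupd hrun => ?_⟩
    · rw [measure_univ]
      exact ENNReal.ofReal_le_one.2 (by linarith)
    · refine sub_mixtureValue_le hK fun k hk => ?_
      have : policySeq upd f k = μ := Finset.card_le_one.1 hP1 _
        (h.policySeq_mem hupd hrun.mem k hk.le) _ h.behavior_mem
      simp only [this, sub_self, integral_zero, add_zero]
      positivity
  have hn2 : 2 ≤ n := by
    rw [hn, mul_right_comm]
    nlinarith [Nat.mul_pos hF hW]
  have hn' : (2 : ℝ) ≤ n := by exact_mod_cast hn2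
  have hx : 1 < 4 * (n : ℝ) / δ := (one_lt_div hδ0).2 (by linarith)
  set L := Real.log (4 * n / δ) with hL
  have hL0 : 0 < L := Real.log_pos hx
  set ρ := bernsteinRadius (2 * Vmax * C) (2 * Vmax * Bw) L N with hρ
  have hρs : ρ ≤ 8 * statError Vmax C Bw n δ N :=
    bernsteinRadius_le_statError hV hC0 hB hn2 hδ0 hδ1
  have hmeas := h.measurableSet_goodEvent ρ N
  refine ⟨goodEvent M F W Pi μ ρ N, hmeas, ?_, fun D hD β K upd f hβ hK hupd hrun => ?_⟩
  · have hc := h.compl_goodEvent_le hN hL0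
    have hδ : (n : ℝ) * (4 * Real.exp (-L)) = δ := by
      rw [Real.exp_neg, hL, Real.exp_log (by positivity)]
      field_simp
    rw [← hn, hδ, ← hρ, prob_compl_eq_one_sub hmeas] at hc
    rw [ENNReal.ofReal_sub _ hδ0.le, ENNReal.ofReal_one]
    exact tsub_le_iff_tsub_le.1 hc
  · have hs := Real.sqrt_nonneg εF
    have hs1 : √εF ≤ C * √εF := le_mul_of_one_le_left hs hC
    refine (sub_mixtureValue_le hK (b := 2 * √εF + 2 * ρ + β * (C * √εF + ρ)) fun k hk => ?_).trans
      (add_le_add_left ?_ _)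
    · have hπ := h.policySeq_mem hupd hrun.mem k hk.le
      rcases hrun with hr | hr
      · exact h.one_round hD hβ (Or.inl rfl) hπ (hr k hk).1 (hr k hk).2
      · exact h.one_round hD hβ (Or.inr rfl) hπ (hr k hk).1 (hr k hk).2
    · nlinarith [mul_le_mul_of_nonneg_left hρs hβ, mul_nonneg hβ hstat,
        mul_nonneg hβ (mul_nonneg hC0 hs)]

/-- For `β = o(√N)` the penalized statistical error vanishes at every fixed confidence. -/
lemma tendsto_mul_statError {β : ℕ → ℝ} (hβ : β =o[atTop] fun N : ℕ => √(N : ℝ))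
    (c Vmax C B δ : ℝ) (n : ℕ) :
    Tendsto (fun N : ℕ => c * ((β N + 1) * statError Vmax C B n δ N)) atTop (𝓝 0) := by
  have hsq : Tendsto (fun N : ℕ => (√(N : ℝ))⁻¹) atTop (𝓝 0) :=
    tendsto_inv_atTop_zero.comp (Real.tendsto_sqrt_atTop.comp tendsto_natCast_atTop_atTop)
  have h1 : Tendsto (fun N : ℕ => (β N + 1) * (√(N : ℝ))⁻¹) atTop (𝓝 0) := by
    have := hβ.tendsto_div_nhds_zero.add hsq
    rw [add_zero] at this
    refine this.congr fun N => ?_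
    rw [div_eq_mul_inv]
    ring
  set l := Real.log (n / δ)
  have h2 : Tendsto (fun N : ℕ => Vmax * C * √l + Vmax * B * l * (√(N : ℝ))⁻¹) atTop
      (𝓝 (Vmax * C * √l + Vmax * B * l * 0)) := (hsq.const_mul _).const_add _
  have h3 := (h1.mul h2).const_mul c
  rw [zero_mul, mul_zero] at h3
  refine h3.congr fun N => ?_
  have hN : (N : ℝ) = √(N : ℝ) * √(N : ℝ) := (Real.mul_self_sqrt (Nat.cast_nonneg N)).symm
  have : statError Vmax C B n δ N =
      (√(N : ℝ))⁻¹ * (Vmax * C * √l + Vmax * B * l * (√(N : ℝ))⁻¹) := by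
    rw [statError, Real.sqrt_div' _ (Nat.cast_nonneg N)]
    conv_lhs => rw [div_eq_mul_inv (_ * _) (N : ℝ), hN, mul_inv, ← hN]
    rw [div_eq_mul_inv]
    ring
  rw [this]
  ring

/-- A no-regret oracle and `β = o(√N)` make the excess suboptimality vanish in probability. -/
lemma Assumptions.tendsto_measure_failure (h : Assumptions M F W Pi μ Vmax Bw C εF)
    {PO : (N K : ℕ) → Dataset S A N → Policy S A → (S × A → ℝ) → Policy S A}
    {β : ℕ → ℝ} {K : ℕ → ℕ} (hPO : ∀ (N K : ℕ) (D : Dataset S A N), StaysIn Pi F (PO N K D))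
    (hreg : IsNoRegret M F Pi PO) (hβ0 : ∀ N, 0 ≤ β N)
    (hβ : β =o[atTop] fun N : ℕ => √(N : ℝ)) (hK : Tendsto K atTop atTop) {η : ℝ} (hη : 0 < η) :
    Tendsto (fun N : ℕ => M.dataLaw μ N {D | ∃ f : ℕ → S × A → ℝ,
        IsACrabRun M D F W (β N) (PO N (K N) D) (K N) f ∧
        16 * ((β N + 1) * (C * √εF)) + η <
          M.J μ - M.mixtureValue (policySeq (PO N (K N) D) f) (K N)})
      atTop (𝓝 0) := by
  rw [ENNReal.tendsto_nhds_zero]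
  intro ε hε
  obtain ⟨r, hr0, hrε⟩ := ENNReal.lt_iff_exists_nnreal_btwn.1 hε
  have hr0' : (0 : ℝ) < r := by exact_mod_cast hr0
  set δ : ℝ := min r (1 / 2) with hδ
  have hδ0 : 0 < δ := lt_min hr0' (by norm_num)
  have hδ1 : δ < 1 := (min_le_right _ _).trans_lt (by norm_num)
  have hδε : ENNReal.ofReal δ ≤ ε := by
    refine (ENNReal.ofReal_le_ofReal (min_le_left _ _)).trans ?_
    rw [ENNReal.ofReal_coe_nnreal]
    exact hrε.le
  obtain ⟨K₀, hK₀⟩ := hreg μ h.behavior_mem (η / 2) (by linarith)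
  have hstat := tendsto_mul_statError hβ 16 Vmax C Bw δ (F.card * Pi.card * W.card)
  filter_upwards [hstat.eventually_le_const (half_pos hη), hK.eventually_ge_atTop K₀,
    hK.eventually_ge_atTop 1, eventually_ge_atTop 1] with N hsN hKN hK1 hN
  obtain ⟨E, hE, hEδ, hbound⟩ := h.high_probability_bound hN hδ0 hδ1
  have hcompl : M.dataLaw μ N Eᶜ ≤ ENNReal.ofReal δ := by
    rw [prob_compl_eq_one_sub hE, tsub_le_iff_tsub_le, ← ENNReal.ofReal_one,
      ← ENNReal.ofReal_sub _ hδ0.le]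
    exact hEδ
  refine ((measure_mono ?_).trans hcompl).trans hδε
  rintro D ⟨f, hrun, hlt⟩ hDE
  have h1 := hbound D hDE (β N) (K N) _ f (hβ0 N) hK1 (hPO N (K N) D) hrun
  have h2 := hK₀ (K N) hKN N D f hrun.mem
  linarith

end Main

end ACrab

theorem theorem2 :
    ∃ c : ℝ, 0 < c ∧
      ∀ (S A : Type*) [MeasurableSpace S] [MeasurableSpace A] [Fintype A] [Nonempty A]
        [MeasurableSingletonClass A] (M : MDP S A)
        (F W : Finset (S × A → ℝ)) (Pi : Finset (Policy S A)) (μ : Policy S A)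
        (Vmax Bw C εF : ℝ),
        1 ≤ Vmax →
        (∀ f ∈ F, Measurable f ∧ ∀ x, f x ∈ Set.Icc 0 Vmax) →
        (∀ w ∈ W, Measurable w ∧ ∀ x, w x ∈ Set.Icc 0 Bw) →
        (fun _ => 1) ∈ W →
        uniformPolicy S A ∈ Pi →
        μ ∈ Pi →
        ApproxRealizable M F Pi εF →
        (∀ w ∈ W, norm2 (M.occupancy μ) w ≤ C) →
        -- the high-probability bound
        (∀ (N : ℕ) (δ : ℝ), 1 ≤ N → 0 < δ → δ < 1 →
          ∃ E : Set (Dataset S A N), MeasurableSet E ∧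
            ENNReal.ofReal (1 - δ) ≤ M.dataLaw μ N E ∧
            ∀ D ∈ E, ∀ (β : ℝ) (K : ℕ) (upd : Policy S A → (S × A → ℝ) → Policy S A)
              (f : ℕ → S × A → ℝ),
              0 ≤ β → 1 ≤ K → StaysIn Pi F upd → IsACrabRun M D F W β upd K f →
              M.J μ - M.mixtureValue (policySeq upd f) K ≤
                c * ((β + 1) *
                  (statError Vmax C Bw (F.card * Pi.card * W.card) δ N + C * √εF)) +
                M.optError μ (policySeq upd f) f K) ∧
        -- policy improvement for every choice `β = o(√N)`, with a no-regret oracle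
        (∀ (PO : (N K : ℕ) → Dataset S A N → Policy S A → (S × A → ℝ) → Policy S A)
          (β : ℕ → ℝ) (K : ℕ → ℕ),
          (∀ (N K : ℕ) (D : Dataset S A N), StaysIn Pi F (PO N K D)) →
          IsNoRegret M F Pi PO →
          (∀ N, 0 ≤ β N) → β =o[atTop] (fun N : ℕ => √(N : ℝ)) → Tendsto K atTop atTop →
          ∀ η > 0, Tendsto (fun N : ℕ => M.dataLaw μ N {D | ∃ f : ℕ → S × A → ℝ,
              IsACrabRun M D F W (β N) (PO N (K N) D) (K N) f ∧
              c * ((β N + 1) * (C * √εF)) + η <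
                M.J μ - M.mixtureValue (policySeq (PO N (K N) D) f) (K N)})
            atTop (𝓝 0)) := by
  refine ⟨16, by norm_num, ?_⟩
  intro S A _ _ _ _ _ M F W Pi μ Vmax Bw C εF hV hF hW hone hunif hμ hreal hnorm
  have h : Assumptions M F W Pi μ Vmax Bw C εF :=
    ⟨hV, hF, hW, hone, hunif, hμ, hreal, hnorm⟩
  exact ⟨fun N δ hN hδ0 hδ1 => h.high_probability_bound hN hδ0 hδ1,
    fun PO β K hPO hreg hβ0 hβ hK η hη => h.tendsto_measure_failure hPO hreg hβ0 hβ hK hη⟩
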